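/- All local cohomology below is computed at closed points of spectra of noetherian local rings: for $X=\operatorname{Spec}R$ with $(R,\mathfrak m_R)$ noetherian local and closed point $x$, and $M$ an $R$-module with associated quasi-coherent sheaf $\mathcal F$, $H^i_x(\mathcal F)=H^i_{\mathfrak m_R}(M)$. **Definitions.** (a) A morphism of schemes $f:X\to Y$ is *flat in codimension $c$* if there is a closed subset $Z\subseteq X$ such that $\operatorname{codim}(Z\cap X_y,X_y)\ge c+1$ for every $y\in Y$ and $f|_{X\setminus Z}$ is flat (the empty set has codimension $\infty$). (b) Let $A$ be a noetherian ring and $(T,\mathfrak n)$ a noetherian local $A$-algebra. Then $T$ (or $\operatorname{Spec}T$ with its closed point) has *liftable $i$-th local cohomology over $A$* if for every noetherian local $A$-algebra $(R,\mathfrak m_R)$ and every nilpotent ideal $I\subset R$ with $R/I\simeq T$ as $A$-algebras, the natural map $H^i_{\mathfrak m_R}(R)\to H^i_{\mathfrak n}(T)$ is surjective. **Proposition.** Let $(S,\mathfrak m,k)$ be an Artinian local ring, let $(X,x)$ be a noetherian local scheme of dimension $n$ (that is, $X=\operatorname{Spec}R$ for a noetherian local ring $R$ of dimension $n$, with closed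 point $x$), and let $f:(X,x)\to(\operatorname{Spec}S,\mathfrak m)$ be a local morphism which is flat in codimension $t-1$. Let $X_k$ be the fibre of $f$ over the closed point of $\operatorname{Spec}S$, and assume that $(X_k,x)$ has liftable $i$-th local cohomology over $S$ for every $i\ge n-t$. Let $N$ be a finite $S$-module with a filtration $$N=N_0\supsetneq N_1\supsetneq\dots\supsetneq N_q\supsetneq N_{q+1}=0$$ by $S$-submodules such that $N_j/N_{j+1}\simeq k$ as $S$-modules for $j=0,\dots,q$. Then for every $i>n-t$ and every $j=0,\dots,q$ the natural sequence $$0\to H^i_x(f^*N_{j+1})\to H^i_x(f^*N_j)\to H^i_x\bigl(f^*(N_j/N_{j+1})\bigr)\to 0,$$ induced by $N_{j+1}\hookrightarrow N_j\twoheadrightarrow N_j/N_{j+1}$, is exact, and every isomorphism $N_j/N_{j+1}\simeq k$ induces an isomorphism $H^i_x(f^*(N_j/N_{j+1}))\simeq H^i_x(\mathcal O_{X_k})$. -/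

import Mathlib

open CategoryTheory AlgebraicGeometry TensorProduct

universe u

namespace LocalCohomologyLifting

section Codimension

/-- The codimension of a closed subset `Z` of a topological space `X`: the infimum, over the
irreducible closed subsets `W` contained in `Z`, of the supremum of the lengths of chains
`W = W₀ ⊊ W₁ ⊊ ⋯` of irreducible closed subsets of `X`. The empty set has codimension `∞`. -/
noncomputable def topologicalCodim {X : Type u} [TopologicalSpace X] (Z : Set X) : ℕ∞ :=
  ⨅ (W : TopologicalSpace.IrreducibleCloseds X) (_ : (W : Set X) ⊆ Z), Order.coheight W

/-- A morphism of schemes `f : X ⟶ Y` is flat in codimension `c` if there is a closed subset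
`Z ⊆ X` such that `codim (Z ∩ X_y, X_y) ≥ c + 1` for every `y : Y`, where `X_y` is the
scheme-theoretic fibre, and such that the restriction of `f` to `X ∖ Z` is flat. For `c + 1 ≤ 0`
the condition on the codimension is empty. -/
def FlatInCodimension {X Y : Scheme.{u}} (f : X ⟶ Y) (c : ℤ) : Prop :=
  ∃ Z : TopologicalSpace.Closeds X,
    (∀ y : Y, ((c + 1).toNat : ℕ∞) ≤ topologicalCodim (f.fiberι y ⁻¹' (Z : Set X))) ∧
    Flat (Scheme.Opens.ι Z.compl ≫ f)

end Codimension

section LocalCohomology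

variable (R : Type u) [CommRing R] [IsLocalRing R]

/-- The local cohomology module `H^i_𝔪(M)` of a module `M` over a local ring `(R, 𝔪)`. For `R`
noetherian and `X = Spec R` with closed point `x`, this is the cohomology with support at `x`
of the quasi-coherent sheaf on `X` associated with `M`. -/
noncomputable abbrev LocalCoh (i : ℕ) (M : Type u) [AddCommGroup M] [Module R M] :
    ModuleCat.{u} R :=
  (localCohomology (IsLocalRing.maximalIdeal R) i).obj (ModuleCat.of R M)

variable {R}

/-- The map `H^i_𝔪(M) → H^i_𝔪(M')` induced by an `R`-linear map `M → M'`. -/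
noncomputable abbrev LocalCoh.map (i : ℕ) {M M' : Type u} [AddCommGroup M] [Module R M]
    [AddCommGroup M'] [Module R M'] (φ : M →ₗ[R] M') : LocalCoh R i M →ₗ[R] LocalCoh R i M' :=
  ((localCohomology (IsLocalRing.maximalIdeal R) i).map (ModuleCat.ofHom φ)).hom

end LocalCohomology

/-- A noetherian local `A`-algebra `(T, 𝔫)` has liftable `i`-th local cohomology over `A` if for
every noetherian local `A`-algebra `(R, 𝔪)` and every surjective homomorphism of `A`-algebras
`R → T` with nilpotent kernel `I` (so that `R/I ≃ T`), the natural map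
`H^i_𝔪(R) → H^i_𝔪(T) = H^i_𝔫(T)` is surjective. Here `T` is regarded as an `R`-module, the local
cohomology of which with respect to `𝔪` is that of `T` with respect to `𝔫 = 𝔪T`. -/
def HasLiftableLocalCoh (A : Type u) [CommRing A] [IsNoetherianRing A] (T : Type u) [CommRing T]
    [IsLocalRing T] [IsNoetherianRing T] [Algebra A T] (i : ℕ) : Prop :=
  ∀ (R : Type u) [CommRing R] [IsLocalRing R] [IsNoetherianRing R] [Algebra A R] [Algebra R T]
    [IsScalarTower A R T],
    Function.Surjective (algebraMap R T) → IsNilpotent (RingHom.ker (algebraMap R T)) →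
    Function.Surjective (LocalCoh.map i (Algebra.linearMap R T))

/-- A filtration `N = N₀ ⊋ N₁ ⊋ ⋯ ⊋ N_q ⊋ N_{q+1} = 0` of a module over a local ring `(S, 𝔪, k)`
such that `N_j / N_{j+1} ≃ k` as `S`-modules for all `j = 0, …, q`. -/
structure IsMaximalFiltration {S : Type u} [CommRing S] [IsLocalRing S] {N : Type u}
    [AddCommGroup N] [Module S N] {q : ℕ} (F : Fin (q + 2) → Submodule S N) : Prop where
  zero_eq_top : F 0 = ⊤
  last_eq_bot : F (Fin.last (q + 1)) = ⊥
  succ_lt (j : Fin (q + 1)) : F j.succ < F j.castSucc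
  quotient_equiv (j : Fin (q + 1)) :
    Nonempty ((F j.castSucc ⧸ (F j.succ).submoduleOf (F j.castSucc)) ≃ₗ[S]
      IsLocalRing.ResidueField S)

section ClosedFibre

variable (S : Type u) [CommRing S] [IsLocalRing S] (R : Type u) [CommRing R] [Algebra S R]

/-- The coordinate ring `R ⊗_S k` of the closed fibre `X_k` of `X = Spec R → Spec S`. As `X_k` is
the spectrum of a local ring, this is also the local ring of `X_k` at its closed point. -/
abbrev ClosedFibre : Type u := R ⊗[S] IsLocalRing.ResidueField S

theorem algebraMap_closedFibre_surjective :
    Function.Surjective (algebraMap R (ClosedFibre S R)) :=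
  Algebra.TensorProduct.includeLeft_surjective (S := R) (A := R) IsLocalRing.residue_surjective

instance [IsNoetherianRing R] : IsNoetherianRing (ClosedFibre S R) :=
  isNoetherianRing_of_surjective R _ (algebraMap R (ClosedFibre S R))
    (algebraMap_closedFibre_surjective S R)

instance [IsLocalRing R] [IsLocalHom (algebraMap S R)] : Nontrivial (ClosedFibre S R) :=
  (Algebra.TensorProduct.lift (IsScalarTower.toAlgHom S R (IsLocalRing.ResidueField R))
    (IsScalarTower.toAlgHom S (IsLocalRing.ResidueField S) (IsLocalRing.ResidueField R))
    (fun _ _ => Commute.all _ _)).toRingHom.domain_nontrivial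

instance [IsLocalRing R] [IsLocalHom (algebraMap S R)] : IsLocalRing (ClosedFibre S R) :=
  IsLocalRing.of_surjective' (algebraMap R (ClosedFibre S R))
    (algebraMap_closedFibre_surjective S R)

end ClosedFibre

end LocalCohomologyLifting

/-! Since `R ⊗[S] -` is right exact, the only obstruction to a short exact sequence of pullbacks is
the kernel `K` of `f^*N_{j+1} → f^*N_j`. It vanishes wherever `f` is flat, so it is supported in
`Z`, whose points have height at least `t` in `Spec R`. Hence `dim K ≤ n - t < i`
(`supportDim_ker_baseChange_lt`), and Grothendieck vanishing (`subsingleton_of_supportDim_lt`) gives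
`H^i(K) = H^{i+1}(K) = 0`: replacing `f^*N_{j+1}` by its image in `f^*N_j` does not change `H^i`.

Surjectivity comes from liftability. An element of `N_j` over `1 ∈ k` gives a map `R → f^*N_j` whose
composite to `𝒪_{X_k}` is the quotient map, with nilpotent kernel because `𝔪` is nilpotent. So
`H^p(f^*N_j) → H^p(f^*k)` is onto for all `p ≥ n - t` (`surjective_map_of_hasLiftableLocalCoh`).
Applied in degree `i - 1`, this kills the connecting map into `H^i` and yields injectivity
(`LocalCoh.shortExact_of_surjective`).

The required pieces of the long exact sequence are obtained by chasing cochains: `H^i_J(M)` is the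
colimit of `Ext^i(R/J^t, M)`, so a class is a cocycle on a projective resolution of some `R/J^t`,
and it is zero when it becomes a coboundary at a later stage. -/

/-! ### Naturality of the computation of `Ext` by a projective resolution. -/

namespace HomologicalComplex

variable {V : Type*} [Category* V] [Abelian V] {ι : Type*} {c : ComplexShape ι}

/-- The morphism between unopposite complexes induced by a morphism of complexes. -/
def unopMap {K L : HomologicalComplex Vᵒᵖ c} (φ : K ⟶ L) : L.unop ⟶ K.unop :=
  (HomologicalComplex.unopFunctor V c).map φ.op

lemma homologyUnop_hom_naturality {K L : HomologicalComplex Vᵒᵖ c} (φ : K ⟶ L) (i : ι) :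
    (L.homologyUnop i).hom ≫ (homologyMap φ i).unop =
      homologyMap (unopMap φ) i ≫ (K.homologyUnop i).hom :=
  congrArg Quiver.Hom.unop (homologyOp_hom_naturality (unopMap φ) i)

lemma homologyUnop_inv_naturality {K L : HomologicalComplex Vᵒᵖ c} (φ : K ⟶ L) (i : ι) :
    (homologyMap φ i).unop ≫ (K.homologyUnop i).inv =
      (L.homologyUnop i).inv ≫ homologyMap (unopMap φ) i := by
  rw [Iso.comp_inv_eq, Category.assoc, Iso.eq_inv_comp, homologyUnop_hom_naturality]

end HomologicalComplex

namespace CategoryTheory.ProjectiveResolution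

open Limits

variable (R : Type*) [Ring R] {C : Type*} [Category* C] [Abelian C] [Linear R C]

/-- The map on complexes of cochains induced by a chain map. -/
noncomputable def precompCochains {K L : ChainComplex C ℕ} (φ : K ⟶ L) (Y : C) :
    L.linearYonedaObj R Y ⟶ K.linearYonedaObj R Y :=
  HomologicalComplex.unopMap
    ((((linearYoneda R C).obj Y).rightOp.mapHomologicalComplex _).map φ)

/-- The map on complexes of cochains induced by a morphism of coefficients. -/
noncomputable def postcompCochains (K : ChainComplex C ℕ) {Y Y' : C} (g : Y ⟶ Y') :
    K.linearYonedaObj R Y ⟶ K.linearYonedaObj R Y' :=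
  HomologicalComplex.unopMap
    ((NatTrans.mapHomologicalComplex (NatTrans.rightOp ((linearYoneda R C).map g)) _).app K)

variable [EnoughProjectives C]

/-- `Ext` is a left derived functor with values in the opposite category, so this is the naturality
of `isoLeftDerivedObj` with all arrows reversed. -/
lemma map_comp_isoExt_hom {X X' : C} (f : X' ⟶ X) (P' : ProjectiveResolution X')
    (P : ProjectiveResolution X) (φ : P'.complex ⟶ P.complex)
    (comm : φ.f 0 ≫ P.π.f 0 = P'.π.f 0 ≫ f) (n : ℕ) (Y : C) :
    ((Ext R C n).map f.op).app Y ≫ (P'.isoExt (R := R) n Y).hom =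
      (P.isoExt n Y).hom ≫ HomologicalComplex.homologyMap (precompCochains R φ Y) n := by
  have h := P'.isoLeftDerivedObj_inv_naturality f P φ comm ((linearYoneda R C).obj Y).rightOp n
  have h' := congrArg Quiver.Hom.unop h
  simp only [unop_comp] at h'
  have h2 := HomologicalComplex.homologyUnop_inv_naturality
    ((((linearYoneda R C).obj Y).rightOp.mapHomologicalComplex _).map φ) n
  exact (reassoc_of% h') _ |>.trans (congrArg (_ ≫ ·) h2 |>.trans (Category.assoc _ _ _).symm)

lemma app_comp_isoExt_hom {X : C} (P : ProjectiveResolution X) (n : ℕ) {Y Y' : C} (g : Y ⟶ Y') :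
    ((Ext R C n).obj (Opposite.op X)).map g ≫ (P.isoExt (R := R) n Y').hom =
      (P.isoExt n Y).hom ≫
        HomologicalComplex.homologyMap (postcompCochains R P.complex g) n := by
  have h := P.leftDerived_app_eq (NatTrans.rightOp ((linearYoneda R C).map g)) n
  rw [← Iso.inv_comp_eq] at h
  have h' := congrArg Quiver.Hom.unop h
  simp only [unop_comp] at h'
  have h2 := HomologicalComplex.homologyUnop_inv_naturality
    ((NatTrans.mapHomologicalComplex (NatTrans.rightOp ((linearYoneda R C).map g)) _).app
      P.complex) n
  exact (reassoc_of% h') _ |>.trans (congrArg (_ ≫ ·) h2 |>.trans (Category.assoc _ _ _).symm)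

end CategoryTheory.ProjectiveResolution

/-! ### Cocycles representing `Ext` classes. -/

namespace CategoryTheory.ProjectiveResolution

open Limits

variable {R : Type*} [Ring R] {C : Type*} [Category* C] [Abelian C] [Linear R C]
  [EnoughProjectives C] {X : C} (P : ProjectiveResolution X) {n : ℕ} {Y : C}

/-- The class `x` in `Ext` is represented by the cochain `f` on the projective resolution `P`. -/
def Represents (x : ((Ext R C n).obj (Opposite.op X)).obj Y) (f : P.complex.X n ⟶ Y) : Prop :=
  ∃ z : (P.complex.linearYonedaObj R Y).cycles n,
    (P.complex.linearYonedaObj R Y).iCycles n z = f ∧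
      (P.complex.linearYonedaObj R Y).homologyπ n z = (P.isoExt n Y).hom x

variable {P}

lemma exists_represents (P : ProjectiveResolution X)
    (x : ((Ext R C n).obj (Opposite.op X)).obj Y) :
    ∃ f, P.Represents x f := by
  obtain ⟨z, hz⟩ := (ModuleCat.epi_iff_surjective _).1
    (inferInstance : Epi ((P.complex.linearYonedaObj R Y).homologyπ n)) ((P.isoExt n Y).hom x)
  exact ⟨_, z, rfl, hz⟩

lemma Represents.cocycle {x : ((Ext R C n).obj (Opposite.op X)).obj Y} {f : P.complex.X n ⟶ Y}
    (h : P.Represents x f) (m : ℕ) : P.complex.d m n ≫ f = 0 := by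
  obtain ⟨z, rfl, -⟩ := h
  exact congr($((P.complex.linearYonedaObj R Y).iCycles_d n m) z)

lemma exists_represents_of_cocycle (f : P.complex.X n ⟶ Y)
    (hf : ∀ m, P.complex.d m n ≫ f = 0) :
    ∃ x : ((Ext R C n).obj (Opposite.op X)).obj Y, P.Represents x f := by
  have : Function.Exact ((P.complex.linearYonedaObj R Y).iCycles n)
      ((P.complex.linearYonedaObj R Y).d n (n + 1)) := by
    have := ShortComplex.exact_of_f_is_kernel
      (.mk _ _ ((P.complex.linearYonedaObj R Y).iCycles_d n (n + 1)))
      ((P.complex.linearYonedaObj R Y).cyclesIsKernel n (n + 1) (by simp))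
    exact (ShortComplex.ShortExact.moduleCat_exact_iff_function_exact _).1 this
  obtain ⟨z, hz⟩ := (this f).1 (hf (n + 1))
  exact ⟨(P.isoExt n Y).inv ((P.complex.linearYonedaObj R Y).homologyπ n z), z, hz, by simp⟩

lemma Represents.sub {x y : ((Ext R C n).obj (Opposite.op X)).obj Y} {f g : P.complex.X n ⟶ Y}
    (hx : P.Represents x f) (hy : P.Represents y g) : P.Represents (x - y) (f - g) := by
  obtain ⟨z, rfl, hz⟩ := hx
  obtain ⟨w, rfl, hw⟩ := hy
  exact ⟨z - w, map_sub _ z w, by simp [hz, hw]⟩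

lemma Represents.smul {x : ((Ext R C n).obj (Opposite.op X)).obj Y} {f : P.complex.X n ⟶ Y}
    (hx : P.Represents x f) (r : R) : P.Represents (r • x) (r • f) := by
  obtain ⟨z, rfl, hz⟩ := hx
  exact ⟨r • z, map_smul _ r z, by simp [hz]⟩

/-- Leaving `p` free avoids a case distinction: `d n p` is zero unless `n = p + 1`, so in degree `0`
the right-hand side just says `f = 0`. -/
lemma Represents.eq_zero_iff {x : ((Ext R C n).obj (Opposite.op X)).obj Y}
    {f : P.complex.X n ⟶ Y} (hx : P.Represents x f) :
    x = 0 ↔ ∃ (p : ℕ) (g : P.complex.X p ⟶ Y), P.complex.d n p ≫ g = f := by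
  have hinj : Function.Injective (P.isoExt (R := R) n Y).hom :=
    (ModuleCat.mono_iff_injective _).1 inferInstance
  have hi : Function.Injective ((P.complex.linearYonedaObj R Y).iCycles n) :=
    (ModuleCat.mono_iff_injective _).1 inferInstance
  obtain ⟨z, rfl, hz⟩ := hx
  rw [← map_eq_zero_iff _ hinj, ← hz]
  have hex (p : ℕ) (hp : (ComplexShape.up ℕ).prev n = p) :
      Function.Exact ((P.complex.linearYonedaObj R Y).toCycles p n)
        ((P.complex.linearYonedaObj R Y).homologyπ n) := by
    have := ShortComplex.exact_of_g_is_cokernel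
      (.mk _ _ ((P.complex.linearYonedaObj R Y).toCycles_comp_homologyπ p n))
      ((P.complex.linearYonedaObj R Y).homologyIsCokernel p n hp)
    exact (ShortComplex.ShortExact.moduleCat_exact_iff_function_exact _).1 this
  constructor
  · intro h
    obtain ⟨g, hg⟩ := (hex _ rfl z).1 h
    refine ⟨_, g, ?_⟩
    rw [← hg]
    exact congr($((P.complex.linearYonedaObj R Y).toCycles_i _ n) g).symm
  · rintro ⟨p, g, hg⟩
    by_cases hp : (ComplexShape.up ℕ).Rel p n
    · refine (hex p ((ComplexShape.up ℕ).prev_eq' hp) z).2 ⟨g, hi ?_⟩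
      rw [← hg]
      exact congr($((P.complex.linearYonedaObj R Y).toCycles_i _ n) g)
    · have : z = 0 := hi <| by
        rw [map_zero, ← hg, P.complex.shape _ _ hp, zero_comp]; rfl
      rw [this, map_zero]

lemma Represents.map_right {x : ((Ext R C n).obj (Opposite.op X)).obj Y}
    {f : P.complex.X n ⟶ Y} (hx : P.Represents x f) {Y' : C} (g : Y ⟶ Y') :
    P.Represents (((Ext R C n).obj (Opposite.op X)).map g x) (f ≫ g) := by
  obtain ⟨z, rfl, hz⟩ := hx
  refine ⟨HomologicalComplex.cyclesMap (postcompCochains R P.complex g) n z, ?_, ?_⟩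
  · exact congr($(HomologicalComplex.cyclesMap_i (postcompCochains R P.complex g) n) z)
  · refine congr($(HomologicalComplex.homologyπ_naturality (postcompCochains R P.complex g) n)
      z).symm.trans ?_
    refine .trans ?_ congr($(app_comp_isoExt_hom R P n g) x).symm
    rw [ModuleCat.comp_apply, ModuleCat.comp_apply, hz]

lemma Represents.map_left {x : ((Ext R C n).obj (Opposite.op X)).obj Y}
    {f : P.complex.X n ⟶ Y} (hx : P.Represents x f) {X' : C} {h : X' ⟶ X}
    {P' : ProjectiveResolution X'} (φ : P'.complex ⟶ P.complex)
    (comm : φ.f 0 ≫ P.π.f 0 = P'.π.f 0 ≫ h) :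
    P'.Represents (((Ext R C n).map h.op).app Y x) (φ.f n ≫ f) := by
  obtain ⟨z, rfl, hz⟩ := hx
  refine ⟨HomologicalComplex.cyclesMap (precompCochains R φ Y) n z, ?_, ?_⟩
  · exact congr($(HomologicalComplex.cyclesMap_i (precompCochains R φ Y) n) z)
  · refine congr($(HomologicalComplex.homologyπ_naturality (precompCochains R φ Y) n)
      z).symm.trans ?_
    refine .trans ?_ congr($(map_comp_isoExt_hom R h P' P φ comm n Y) x).symm
    rw [ModuleCat.comp_apply, ModuleCat.comp_apply, hz]

end CategoryTheory.ProjectiveResolution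

namespace CategoryTheory.ProjectiveResolution

variable {R : Type*} [Ring R] {C : Type*} [Category* C] [Abelian C] [Linear R C]
  [EnoughProjectives C] {X : C} {P : ProjectiveResolution X} {n : ℕ} {Y : C}

lemma Represents.eq {x y : ((Ext R C n).obj (Opposite.op X)).obj Y} {f : P.complex.X n ⟶ Y}
    (hx : P.Represents x f) (hy : P.Represents y f) : x = y :=
  sub_eq_zero.1 <| (hx.sub hy).eq_zero_iff.2 ⟨0, 0, by simp⟩

end CategoryTheory.ProjectiveResolution

/-! ### Cochains representing local cohomology classes. -/

namespace localCohomology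

open Opposite Limits

variable {R : Type u} [CommRing R] {J : Ideal R} {i : ℕ}

/-- The structure map from an `Ext` module to the local cohomology. -/
noncomputable def ofExt (J : Ideal R) (i t : ℕ) (M : ModuleCat.{u} R) :
    ((Ext R (ModuleCat.{u} R) i).obj (op (ModuleCat.of R (R ⧸ J ^ t)))).obj M ⟶
      (localCohomology J i).obj M :=
  (colimit.ι (diagram (idealPowersDiagram J) i) (op (op t))).app M

variable (J) in
/-- The projection `R/J^s → R/J^t` for `t ≤ s`. -/
noncomputable def transition {s t : ℕ} (h : t ≤ s) :
    ModuleCat.of R (R ⧸ J ^ s) ⟶ ModuleCat.of R (R ⧸ J ^ t) :=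
  (ringModIdeals (idealPowersDiagram J)).map (homOfLE h).op

/-- The local cohomology of a module as a colimit of modules. -/
noncomputable def isColimitEvaluation (J : Ideal R) (i : ℕ) (M : ModuleCat.{u} R) :
    IsColimit (((evaluation _ _).obj M).mapCocone
      (colimit.cocone (diagram (idealPowersDiagram J) i))) :=
  isColimitOfPreserves _ (colimit.isColimit _)

instance : PreservesColimitsOfShape ℕᵒᵖᵒᵖ (forget (ModuleCat.{u} R)) :=
  have : PreservesFilteredColimitsOfSize.{0, 0} (forget (ModuleCat.{u} R)) :=
    preservesFilteredColimitsOfSize_shrink.{0, u, 0, u} _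
  inferInstance

lemma exists_ofExt_eq {M : ModuleCat.{u} R} (x : (localCohomology J i).obj M) :
    ∃ (t : ℕ) (y : _), ofExt J i t M y = x := by
  obtain ⟨t, y, hy⟩ := Concrete.isColimit_exists_rep _ (isColimitEvaluation J i M) x
  exact ⟨t.unop.unop, y, hy⟩

lemma ofExt_map_transition {s t : ℕ} (h : t ≤ s) {M : ModuleCat.{u} R}
    (y : ((Ext R (ModuleCat.{u} R) i).obj (op (ModuleCat.of R (R ⧸ J ^ t)))).obj M) :
    ofExt J i s M (((Ext R (ModuleCat.{u} R) i).map (transition J h).op).app M y) =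
      ofExt J i t M y :=
  congr($((((evaluation _ _).obj M).mapCocone
      (colimit.cocone (diagram (idealPowersDiagram J) i))).w
      (show op (op t) ⟶ op (op s) from (homOfLE h).op.op)) y)

lemma ofExt_eq_zero {t : ℕ} {M : ModuleCat.{u} R}
    {y : ((Ext R (ModuleCat.{u} R) i).obj (op (ModuleCat.of R (R ⧸ J ^ t)))).obj M}
    (hy : ofExt J i t M y = 0) :
    ∃ (s : ℕ) (h : t ≤ s),
      ((Ext R (ModuleCat.{u} R) i).map (transition J h).op).app M y = 0 := by
  obtain ⟨k, f, g, e⟩ := Concrete.isColimit_exists_of_rep_eq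
    (diagram (idealPowersDiagram J) i ⋙ (evaluation _ _).obj M) (isColimitEvaluation J i M)
    (i := op (op t)) (j := op (op t)) y 0 (hy.trans (map_zero (ofExt J i t M).hom).symm)
  exact ⟨k.unop.unop, leOfHom f.unop.unop, e.trans (map_zero (ModuleCat.Hom.hom _))⟩

lemma map_ofExt {t : ℕ} {M M' : ModuleCat.{u} R} (g : M ⟶ M')
    (y : ((Ext R (ModuleCat.{u} R) i).obj (op (ModuleCat.of R (R ⧸ J ^ t)))).obj M) :
    (localCohomology J i).map g (ofExt J i t M y) =
      ofExt J i t M' (((Ext R (ModuleCat.{u} R) i).obj _).map g y) :=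
  congr($((colimit.ι (diagram (idealPowersDiagram J) i) (op (op t))).naturality g) y).symm

variable (J) in
/-- A projective resolution of `R/J^t`. -/
noncomputable def resolution (t : ℕ) : ProjectiveResolution (ModuleCat.of R (R ⧸ J ^ t)) :=
  projectiveResolution _

variable (J) in
/-- A chain map lifting the projection `R/J^s → R/J^t`. -/
noncomputable def resolutionMap {s t : ℕ} (h : t ≤ s) :
    (resolution J s).complex ⟶ (resolution J t).complex :=
  ProjectiveResolution.lift (transition J h) _ _

lemma resolutionMap_comm {s t : ℕ} (h : t ≤ s) :
    (resolutionMap J h).f 0 ≫ (resolution J t).π.f 0 =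
      (resolution J s).π.f 0 ≫ transition J h :=
  ProjectiveResolution.lift_commutes_zero _ _ _

/-- The local cohomology class `x` is represented by the cochain `f` on the resolution
of `R/J^t`. -/
def Represents (t : ℕ) {M : ModuleCat.{u} R} (x : (localCohomology J i).obj M)
    (f : (resolution J t).complex.X i ⟶ M) : Prop :=
  ∃ y, (resolution J t).Represents (R := R) y f ∧ ofExt J i t M y = x

variable {M M' : ModuleCat.{u} R}

lemma exists_represents (x : (localCohomology J i).obj M) :
    ∃ t f, Represents t x f := by
  obtain ⟨t, y, rfl⟩ := exists_ofExt_eq x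
  obtain ⟨f, hf⟩ := (resolution J t).exists_represents y
  exact ⟨t, f, y, hf, rfl⟩

lemma exists_represents_of_cocycle {t : ℕ} (f : (resolution J t).complex.X i ⟶ M)
    (hf : ∀ m, (resolution J t).complex.d m i ≫ f = 0) :
    ∃ x : (localCohomology J i).obj M, Represents t x f := by
  obtain ⟨y, hy⟩ := ProjectiveResolution.exists_represents_of_cocycle (R := R) f hf
  exact ⟨_, y, hy, rfl⟩

namespace Represents

variable {t : ℕ} {x y : (localCohomology J i).obj M} {f g : (resolution J t).complex.X i ⟶ M}

lemma cocycle (h : Represents t x f) (m : ℕ) : (resolution J t).complex.d m i ≫ f = 0 := by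
  obtain ⟨y, hy, -⟩ := h
  exact hy.cocycle m

lemma sub (hx : Represents t x f) (hy : Represents t y g) : Represents t (x - y) (f - g) := by
  obtain ⟨x, hx, rfl⟩ := hx
  obtain ⟨y, hy, rfl⟩ := hy
  exact ⟨x - y, hx.sub hy, map_sub (ofExt J i t M).hom x y⟩

lemma eq (hx : Represents t x f) (hy : Represents t y f) : x = y := by
  obtain ⟨x, hx, rfl⟩ := hx
  obtain ⟨y, hy, rfl⟩ := hy
  rw [hx.eq hy]

lemma map (hx : Represents t x f) (g : M ⟶ M') :
    Represents t ((localCohomology J i).map g x) (f ≫ g) := by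
  obtain ⟨x, hx, rfl⟩ := hx
  exact ⟨_, hx.map_right g, (map_ofExt g x).symm⟩

lemma of_le (hx : Represents t x f) {s : ℕ} (h : t ≤ s) :
    Represents s x ((resolutionMap J h).f i ≫ f) := by
  obtain ⟨x, hx, rfl⟩ := hx
  exact ⟨_, hx.map_left _ (resolutionMap_comm h), ofExt_map_transition h x⟩

lemma eq_zero_of_coboundary (hx : Represents t x f) {p : ℕ}
    (g : (resolution J t).complex.X p ⟶ M) (hg : (resolution J t).complex.d i p ≫ g = f) :
    x = 0 := by
  obtain ⟨x, hx, rfl⟩ := hx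
  rw [hx.eq_zero_iff.2 ⟨p, g, hg⟩]
  exact map_zero (ofExt J i t M).hom

/-- The colimit is filtered, so a class that dies in it already dies in `Ext^i(R/J^s, M)` for some
`s ≥ t`. -/
lemma exists_coboundary (hx : Represents t (0 : (localCohomology J i).obj M) f) :
    ∃ (s : ℕ) (h : t ≤ s) (p : ℕ) (g : (resolution J s).complex.X p ⟶ M),
      (resolution J s).complex.d i p ≫ g = (resolutionMap J h).f i ≫ f := by
  obtain ⟨x, hx, h0⟩ := hx
  obtain ⟨s, h, e⟩ := ofExt_eq_zero h0
  exact ⟨s, h, (hx.map_left _ (resolutionMap_comm h)).eq_zero_iff.1 e⟩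

/-- Multiplication by `a` is the zero map on `R/J^t`. Both `0` and `a • 𝟙` on the resolution lift
it, so they induce the same map on `Ext`. -/
lemma smul_eq_zero (hx : Represents t x f) {a : R} (ha : a ∈ J ^ t) : a • x = 0 := by
  obtain ⟨x, hx, rfl⟩ := hx
  have h0 : a • 𝟙 (ModuleCat.of R (R ⧸ J ^ t)) = 0 := by
    refine ModuleCat.hom_ext (LinearMap.ext fun b => ?_)
    obtain ⟨b, rfl⟩ := Ideal.Quotient.mk_surjective b
    change a • Ideal.Quotient.mk (J ^ t) b = 0
    rw [Algebra.smul_def, Ideal.Quotient.algebraMap_eq, Ideal.Quotient.eq_zero_iff_mem.2 ha,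
      zero_mul]
  have h1 := hx.map_left (h := 0) (P' := resolution J t) 0
    (zero_comp.trans comp_zero.symm)
  have h2 := hx.map_left (h := 0) (P' := resolution J t) (a • 𝟙 _) (by
    rw [← h0]
    exact (Linear.smul_comp _ _ _ _ _ _).trans <| .trans
      (congrArg (a • ·) ((Category.id_comp _).trans (Category.comp_id _).symm))
      (Linear.comp_smul _ _ _ _ _ _).symm)
  have h3 := hx.smul a
  have e : a • x = 0 := by
    rw [h3.eq (by simpa using h2)]
    exact h1.eq_zero_iff.2 ⟨0, 0, by simp⟩
  rw [← (ofExt J i t M).hom.map_smul, e]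
  exact map_zero (ofExt J i t M).hom

end Represents

end localCohomology

/-! ### Pieces of the long exact sequence, and vanishing for injective modules. -/

namespace localCohomology

open Opposite Limits

variable {R : Type u} [CommRing R] {J : Ideal R} {i : ℕ}

lemma represents_zero (t : ℕ) {M : ModuleCat.{u} R} :
    Represents t (0 : (localCohomology J i).obj M) 0 := by
  obtain ⟨x, hx⟩ := exists_represents_of_cocycle (J := J) (i := i) (t := t) (M := M) 0 (by simp)
  rwa [← hx.eq_zero_of_coboundary (p := 0) 0 (by simp)]

instance (t i : ℕ) : Projective ((resolution J t).complex.X i) := (resolution J t).projective i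

lemma d_comp_eq_zero_of_ne {t p m : ℕ} {M : ModuleCat.{u} R} (h : m ≠ p + 1)
    (f : (resolution J t).complex.X p ⟶ M) : (resolution J t).complex.d m p ≫ f = 0 := by
  rw [HomologicalComplex.shape _ _ _ (by simpa using h.symm), zero_comp]

lemma map_comp_apply_eq_zero {S : ShortComplex (ModuleCat.{u} R)}
    (x : (localCohomology J i).obj S.X₁) :
    (localCohomology J i).map S.g ((localCohomology J i).map S.f x) = 0 := by
  obtain ⟨t, f, hf⟩ := exists_represents x
  have := (hf.map S.f).map S.g
  rw [Category.assoc, S.zero, comp_zero] at this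
  exact this.eq (represents_zero t)

variable {S : ShortComplex (ModuleCat.{u} R)}

/-- Local cohomology is exact in the middle. -/
theorem exact_map (hS : S.ShortExact) :
    Function.Exact ((localCohomology J i).map S.f) ((localCohomology J i).map S.g) := by
  have := hS.mono_f
  have := hS.epi_g
  refine fun y => ⟨fun hy => ?_, ?_⟩
  · obtain ⟨t, f, hf⟩ := exists_represents y
    have hfg := hf.map S.g
    rw [hy] at hfg
    obtain ⟨s, h, p, θ, hθ⟩ := hfg.exists_coboundary
    replace hf := hf.of_le h
    rw [← Category.assoc] at hθ
    generalize (resolutionMap J h).f i ≫ f = f at hf hθ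
    -- Projectivity lifts `θ` along `S.g`; subtracting the coboundary of this lift from `f` gives a
    -- cocycle killed by `S.g`, which therefore comes from `S.X₁`.
    obtain ⟨w, hw⟩ : ∃ w, w ≫ S.f =
        f - (resolution J s).complex.d i p ≫ Projective.factorThru θ S.g :=
      ⟨hS.exact.lift (f - (resolution J s).complex.d i p ≫ Projective.factorThru θ S.g)
        (by simp [hθ]), hS.exact.lift_f _ _⟩
    obtain ⟨x, hx⟩ := exists_represents_of_cocycle (J := J) w fun m => by
      rw [← cancel_mono S.f, Category.assoc, hw]
      simp [hf.cocycle]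
    refine ⟨x, (sub_eq_zero.1 ?_).symm⟩
    refine (hf.sub (hx.map S.f)).eq_zero_of_coboundary (p := p) (Projective.factorThru θ S.g) ?_
    rw [hw, sub_sub_cancel]
  · rintro ⟨x, rfl⟩
    exact map_comp_apply_eq_zero x

/-- If the previous map in the long exact sequence is surjective, then the next is injective. -/
theorem injective_map_of_surjective (hS : S.ShortExact)
    (hsurj : ∀ p, p + 1 = i → Function.Surjective ((localCohomology J p).map S.g)) :
    Function.Injective ((localCohomology J i).map S.f) := by
  have := hS.mono_f
  have := hS.epi_g
  refine (injective_iff_map_eq_zero ((localCohomology J i).map S.f).hom).2 fun x hx => ?_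
  obtain ⟨t, f, hf⟩ := exists_represents x
  have hfa := hf.map S.f
  rw [show (localCohomology J i).map S.f x = 0 from hx] at hfa
  obtain ⟨s, h, p, g, hg⟩ := hfa.exists_coboundary
  replace hf := hf.of_le h
  rw [← Category.assoc] at hg
  generalize (resolutionMap J h).f i ≫ f = f at hf hg
  clear h hfa
  by_cases hp : i = p + 1
  · subst hp
    -- As the coboundary of `g` is `f ≫ S.f`, the cochain `g ≫ S.g` is a cocycle. Its class `y` is
    -- the one whose connecting image is `x`.
    obtain ⟨y, hy⟩ := exists_represents_of_cocycle (J := J) (g ≫ S.g) fun m => by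
      by_cases hm : m = p + 1
      · subst hm
        rw [← Category.assoc, hg, Category.assoc, S.zero, comp_zero]
      · exact d_comp_eq_zero_of_ne hm _
    obtain ⟨z, rfl⟩ := hsurj p rfl y
    obtain ⟨r, g', hg'⟩ := exists_represents z
    -- Pass to a common stage of the colimit, where the cochains for `y` and its lift `z` can be
    -- compared.
    replace hf := hf.of_le (le_max_left s r)
    replace hy := hy.of_le (le_max_left s r)
    replace hg' := hg'.of_le (le_max_right s r)
    replace hg := congrArg ((resolutionMap J (le_max_left s r)).f (p + 1) ≫ ·) hg
    simp only [HomologicalComplex.Hom.comm_assoc] at hg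
    rw [← Category.assoc] at hy
    rw [← Category.assoc _ f] at hg
    generalize (resolutionMap J (le_max_left s r)).f (p + 1) ≫ f = f at hf hg
    generalize (resolutionMap J (le_max_left s r)).f p ≫ g = g at hy hg
    generalize (resolutionMap J (le_max_right s r)).f p ≫ g' = g' at hg'
    generalize max s r = s at f g g'
    have h0 := hy.sub (hg'.map S.g)
    rw [sub_self] at h0
    obtain ⟨r, h, q, θ, hθ⟩ := h0.exists_coboundary
    replace hf := hf.of_le h
    replace hg' := hg'.of_le h
    replace hg := congrArg ((resolutionMap J h).f (p + 1) ≫ ·) hg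
    simp only [HomologicalComplex.Hom.comm_assoc] at hg
    -- The corrected difference of `g` and the cocycle `g'` lands in `S.X₁`, and its coboundary is
    -- still that of `g`, namely `f`.
    obtain ⟨w, hw⟩ : ∃ w, w ≫ S.f = (resolutionMap J h).f p ≫ g - (resolutionMap J h).f p ≫ g' -
        (resolution J r).complex.d p q ≫ Projective.factorThru θ S.g :=
      ⟨hS.exact.lift ((resolutionMap J h).f p ≫ g - (resolutionMap J h).f p ≫ g' -
        (resolution J r).complex.d p q ≫ Projective.factorThru θ S.g)
        (by simp [hθ]), hS.exact.lift_f _ _⟩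
    refine hf.eq_zero_of_coboundary w ?_
    rw [← cancel_mono S.f, Category.assoc, hw]
    simp [hg, hg'.cocycle]
  -- Here the differential is zero; this covers `i = 0`.
  · have hf0 : f = 0 := by
      rw [← cancel_mono S.f, ← hg, d_comp_eq_zero_of_ne hp, zero_comp]
    exact hf.eq_zero_of_coboundary (p := 0) 0 (by rw [hf0, comp_zero])

/-- If the next term in the long exact sequence vanishes, then the map is surjective. -/
theorem surjective_map_of_subsingleton (hS : S.ShortExact)
    [Subsingleton ((localCohomology J (i + 1)).obj S.X₁)] :
    Function.Surjective ((localCohomology J i).map S.g) := by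
  have := hS.mono_f
  have := hS.epi_g
  intro y
  obtain ⟨t, g, hg⟩ := exists_represents y
  -- `f` represents the connecting image of `y`. It vanishes by hypothesis, so a lift of `g` can be
  -- corrected to a cocycle.
  obtain ⟨f, hf⟩ : ∃ f, f ≫ S.f =
      (resolution J t).complex.d (i + 1) i ≫ Projective.factorThru g S.g :=
    ⟨hS.exact.lift ((resolution J t).complex.d (i + 1) i ≫ Projective.factorThru g S.g)
      (by simp [hg.cocycle]), hS.exact.lift_f _ _⟩
  obtain ⟨x, hx⟩ := exists_represents_of_cocycle (J := J) f fun m => by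
    rw [← cancel_mono S.f, Category.assoc, hf]
    simp
  rw [Subsingleton.elim x 0] at hx
  obtain ⟨s, h, p, w, hw⟩ := hx.exists_coboundary
  obtain ⟨w, hw⟩ : ∃ w, (resolution J s).complex.d (i + 1) i ≫ w =
      (resolutionMap J h).f (i + 1) ≫ f := by
    by_cases hp : i + 1 = p + 1
    · obtain rfl : i = p := by omega
      exact ⟨w, hw⟩
    · exact ⟨0, by rw [← hw, d_comp_eq_zero_of_ne hp, comp_zero]⟩
  obtain ⟨z, hz⟩ := exists_represents_of_cocycle (J := J)
    ((resolutionMap J h).f i ≫ Projective.factorThru g S.g - w ≫ S.f) fun m => by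
      by_cases hm : m = i + 1
      · subst hm
        rw [Preadditive.comp_sub, ← Category.assoc _ w, hw, Category.assoc, hf]
        simp
      · exact d_comp_eq_zero_of_ne hm _
  refine ⟨z, ?_⟩
  have h1 := hz.map S.g
  rw [show ((resolutionMap J h).f i ≫ Projective.factorThru g S.g - w ≫ S.f) ≫ S.g =
    (resolutionMap J h).f i ≫ g by simp] at h1
  exact h1.eq (hg.of_le h)

/-- Vanishing of local cohomology of injective modules. -/
theorem subsingleton_of_injective (M : ModuleCat.{u} R) [Injective M] :
    Subsingleton ((localCohomology J (i + 1)).obj M) := by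
  refine subsingleton_of_forall_eq 0 fun x => ?_
  obtain ⟨t, f, hf⟩ := exists_represents x
  refine hf.eq_zero_of_coboundary
    (((resolution J t).exact_succ i).descToInjective f (hf.cocycle _)) ?_
  exact ((resolution J t).exact_succ i).comp_descToInjective _ _

/-- Every local cohomology class is killed by a power of the ideal. -/
theorem exists_pow_smul_eq_zero {M : ModuleCat.{u} R} (x : (localCohomology J i).obj M) :
    ∃ t : ℕ, ∀ a ∈ J ^ t, a • x = 0 := by
  obtain ⟨t, f, hf⟩ := exists_represents x
  exact ⟨t, fun a ha => hf.smul_eq_zero ha⟩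

/-- The augmentation of the resolution of `R/J^t`. -/
noncomputable def augmentation (J : Ideal R) (t : ℕ) :
    (resolution J t).complex.X 0 ⟶ ModuleCat.of R (R ⧸ J ^ t) :=
  (resolution J t).π.f 0

lemma d_comp_augmentation (t : ℕ) :
    (resolution J t).complex.d 1 0 ≫ augmentation J t = 0 :=
  (resolution J t).complex_d_comp_π_f_zero

lemma resolutionMap_comp_augmentation {s t : ℕ} (h : t ≤ s) :
    (resolutionMap J h).f 0 ≫ augmentation J t = augmentation J s ≫ transition J h :=
  resolutionMap_comm h

/-- `H^0_J` preserves surjections from `J`-power torsion modules. -/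
theorem surjective_map_zero_of_torsion {M N : ModuleCat.{u} R} (g : M ⟶ N)
    (hg : Function.Surjective g) (hM : ∀ b : M, ∃ t : ℕ, ∀ a ∈ J ^ t, a • b = 0) :
    Function.Surjective ((localCohomology J 0).map g) := by
  intro y
  obtain ⟨t, f, hf⟩ := exists_represents y
  obtain ⟨f', rfl⟩ : ∃ f' : ModuleCat.of R (R ⧸ J ^ t) ⟶ N, augmentation J t ≫ f' = f :=
    ⟨(resolution J t).exact₀.desc f (hf.cocycle 1), (resolution J t).exact₀.g_desc _ _⟩
  -- A degree `0` class is a map out of `R/J^t`, determined by the image of `1`. A preimage `b` of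
  -- that image is killed by `J^s`, so it defines a map out of `R/J^r` as soon as `r ≥ s`.
  obtain ⟨b, hb⟩ := hg (f' (Ideal.Quotient.mk _ 1))
  obtain ⟨s, hs⟩ := hM b
  let r := max s t
  let h : ModuleCat.of R (R ⧸ J ^ r) ⟶ M := ModuleCat.ofHom <|
    Submodule.liftQ (J ^ r) (LinearMap.toSpanSingleton R M b) fun a ha => by
      exact hs a (Ideal.pow_le_pow_right (le_max_left s t) ha)
  have hh : h ≫ g = transition J (le_max_right s t) ≫ f' := by
    refine ModuleCat.hom_ext ?_
    refine Submodule.linearMap_qext _ (LinearMap.ext_ring ?_)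
    change g ((1 : R) • b) = f' (Ideal.Quotient.mk _ 1)
    rw [one_smul, hb]
  obtain ⟨z, hz⟩ := exists_represents_of_cocycle (J := J) (i := 0) (t := r)
    (augmentation J r ≫ h) fun m => by
      by_cases hm : m = 1
      · subst hm
        rw [← Category.assoc, d_comp_augmentation, zero_comp]
      · exact d_comp_eq_zero_of_ne (by simpa using hm) _
  refine ⟨z, ?_⟩
  have h1 := hz.map g
  have h2 := hf.of_le (le_max_right s t)
  rw [Category.assoc, hh] at h1
  rw [← Category.assoc, resolutionMap_comp_augmentation, Category.assoc] at h2
  exact h1.eq h2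

end localCohomology

/-! ### Power torsion modules. -/

section PowTorsion

variable {R : Type u} [CommRing R] (J : Ideal R)

/-- Every element of the module is killed by a power of the ideal `J`. -/
def IsPowTorsion (M : Type*) [AddCommGroup M] [Module R M] : Prop :=
  ∀ b : M, ∃ t : ℕ, ∀ a ∈ J ^ t, a • b = 0

/-- The submodule of elements killed by a power of the ideal `J`. -/
def powTorsionSubmodule (M : Type*) [AddCommGroup M] [Module R M] : Submodule R M where
  carrier := {b | ∃ t : ℕ, ∀ a ∈ J ^ t, a • b = 0}
  zero_mem' := ⟨0, fun a _ => smul_zero a⟩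
  add_mem' := by
    rintro b c ⟨s, hs⟩ ⟨t, ht⟩
    refine ⟨max s t, fun a ha => ?_⟩
    rw [smul_add, hs a (Ideal.pow_le_pow_right (le_max_left s t) ha),
      ht a (Ideal.pow_le_pow_right (le_max_right s t) ha), add_zero]
  smul_mem' := by
    rintro r b ⟨t, ht⟩
    exact ⟨t, fun a ha => by rw [smul_comm, ht a ha, smul_zero]⟩

variable {J}

lemma isPowTorsion_powTorsionSubmodule (M : Type*) [AddCommGroup M] [Module R M] :
    IsPowTorsion J (powTorsionSubmodule J M) := by
  rintro ⟨b, t, ht⟩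
  exact ⟨t, fun a ha => Subtype.ext (ht a ha)⟩

lemma IsPowTorsion.of_surjective {M N : Type*} [AddCommGroup M] [Module R M] [AddCommGroup N]
    [Module R N] (h : IsPowTorsion J M) (f : M →ₗ[R] N) (hf : Function.Surjective f) :
    IsPowTorsion J N := by
  intro b
  obtain ⟨b, rfl⟩ := hf b
  obtain ⟨t, ht⟩ := h b
  exact ⟨t, fun a ha => by rw [← map_smul, ht a ha, map_zero]⟩

lemma IsPowTorsion.exists_pow_of_fg {M : Type*} [AddCommGroup M] [Module R M]
    (h : IsPowTorsion J M) {N : Submodule R M} (hN : N.FG) :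
    ∃ t : ℕ, ∀ a ∈ J ^ t, ∀ b ∈ N, a • b = 0 := by
  obtain ⟨s, rfl⟩ := hN
  choose t ht using h
  refine ⟨s.sup t, fun a ha b hb => ?_⟩
  induction hb using Submodule.span_induction with
  | mem b hb => exact ht b a (Ideal.pow_le_pow_right (Finset.le_sup hb) ha)
  | zero => exact smul_zero a
  | add b c _ _ hb hc => rw [smul_add, hb, hc, add_zero]
  | smul r b _ hb => rw [smul_comm, hb, smul_zero]

/-- Over a noetherian ring the power torsion of an injective module is injective. -/
lemma injective_powTorsionSubmodule [IsNoetherianRing R] (E : Type u) [AddCommGroup E] [Module R E]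
    [Module.Injective R E] : Module.Injective R (powTorsionSubmodule J E) := by
  refine Module.Baer.injective fun I g => ?_
  -- `J^c` kills the finitely generated image of `g`, and Artin–Rees gives `J^(c+k) ∩ I ⊆ J^c I`.
  -- Hence `g` factors through a submodule of `R/J^(c+k)`. Extending from there, rather than from
  -- `I`, forces the values to be killed by `J^(c+k)`.
  obtain ⟨c, hc⟩ := (isPowTorsion_powTorsionSubmodule (J := J) E).exists_pow_of_fg
    (N := LinearMap.range g) (LinearMap.range_eq_map g ▸ (IsNoetherian.noetherian ⊤).map g)
  obtain ⟨k, hk⟩ := J.exists_pow_inf_eq_pow_smul (M := R) I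
  have hker : Submodule.comap (Submodule.subtype I) (J ^ (c + k)) ≤
      LinearMap.ker ((powTorsionSubmodule J E).subtype ∘ₗ g) := by
    intro x hx
    have hx' : (x : R) ∈ J ^ (c + k) • (⊤ : Submodule R R) ⊓ I :=
      ⟨by simpa using hx, x.2⟩
    rw [hk _ (Nat.le_add_left k c), Nat.add_sub_cancel] at hx'
    have hx2 := Submodule.smul_mono (le_refl (J ^ c))
      (inf_le_right : J ^ k • (⊤ : Submodule R R) ⊓ I ≤ I) hx'
    have hmem : ∀ y ∈ J ^ c • (I : Submodule R R), ∃ hy : y ∈ I, g ⟨y, hy⟩ = 0 := by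
      intro y hy
      refine Submodule.smul_induction_on hy (fun r hr n hn => ?_) ?_
      · refine ⟨I.smul_mem r hn, ?_⟩
        have := map_smul g r ⟨n, hn⟩
        rw [hc r hr _ ⟨_, rfl⟩] at this
        exact this
      · rintro y z ⟨hy, ey⟩ ⟨hz, ez⟩
        refine ⟨I.add_mem hy hz, ?_⟩
        have := map_add g ⟨y, hy⟩ ⟨z, hz⟩
        rw [ey, ez, add_zero] at this
        exact this
    obtain ⟨_, h0⟩ := hmem _ hx2
    rw [LinearMap.mem_ker, LinearMap.comp_apply, h0, map_zero]
  obtain ⟨h, hh⟩ := Module.Injective.out (R := R) (Q := E)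
    (Submodule.mapQ (Submodule.comap (Submodule.subtype I) (J ^ (c + k))) (J ^ (c + k))
      (Submodule.subtype I) le_rfl)
    (by
      refine (injective_iff_map_eq_zero _).2 fun y hy => ?_
      obtain ⟨y, rfl⟩ := Submodule.Quotient.mk_surjective _ y
      rw [Submodule.mapQ_apply, Submodule.Quotient.mk_eq_zero] at hy
      exact (Submodule.Quotient.mk_eq_zero _).2 hy)
    (Submodule.liftQ _ _ hker)
  refine ⟨LinearMap.codRestrict _ (h ∘ₗ Submodule.mkQ (J ^ (c + k))) fun r => ⟨c + k, ?_⟩, ?_⟩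
  · intro a ha
    rw [← map_smul, LinearMap.comp_apply]
    have : Submodule.mkQ (J ^ (c + k)) (a • r) = 0 :=
      (Submodule.Quotient.mk_eq_zero _).2 (Ideal.mul_mem_right _ _ ha)
    rw [this, map_zero]
  · intro x hx
    exact Subtype.ext (hh (Submodule.Quotient.mk ⟨x, hx⟩))

end PowTorsion

/-! ### Vanishing above the dimension of the support. -/

namespace localCohomology

variable {R : Type u} [CommRing R] {J : Ideal R} {i : ℕ}

lemma shortExact_moduleCat {A B C : Type u} [AddCommGroup A] [Module R A] [AddCommGroup B]
    [Module R B] [AddCommGroup C] [Module R C] (f : A →ₗ[R] B) (g : B →ₗ[R] C)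
    (hf : Function.Injective f) (hfg : Function.Exact f g) (hg : Function.Surjective g) :
    (ShortComplex.mk (ModuleCat.ofHom f) (ModuleCat.ofHom g)
      (ModuleCat.hom_ext hfg.linearMap_comp_eq_zero)).ShortExact where
  exact := (ShortComplex.ShortExact.moduleCat_exact_iff_function_exact _).2 hfg
  mono_f := (ModuleCat.mono_iff_injective _).2 hf
  epi_g := (ModuleCat.epi_iff_surjective _).2 hg

/-- Dimension shifting: a torsion module embeds in the torsion part of an injective module, which is
itself injective, and the cokernel is again torsion. The induction starts from the surjectivity of
`H^0` on quotients of torsion modules. -/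
theorem subsingleton_of_isPowTorsion [IsNoetherianRing R] {M : ModuleCat.{u} R}
    (hM : IsPowTorsion J M) : Subsingleton ((localCohomology J (i + 1)).obj M) := by
  induction i using Nat.strong_induction_on generalizing M with | _ i ih
  let E := Injective.under M
  let f₀ : M →ₗ[R] E := (Injective.ι M).hom
  have : Injective (ModuleCat.of R E) := inferInstanceAs (Injective (Injective.under M))
  have : Module.Injective R E :=
    Module.injective_module_of_injective_object R E
  have := injective_powTorsionSubmodule (J := J) E
  let f : M →ₗ[R] powTorsionSubmodule J E :=
    f₀.codRestrict _ fun b => (hM b).imp fun t ht a ha => by rw [← map_smul, ht a ha, map_zero]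
  have hf : Function.Injective f := by
    refine (LinearMap.injective_codRestrict_iff _).2 ?_
    exact (ModuleCat.mono_iff_injective _).1 inferInstance
  have hS := shortExact_moduleCat f (LinearMap.range f).mkQ hf (LinearMap.exact_map_mkQ_range f)
    (Submodule.mkQ_surjective _)
  have : Injective (ModuleCat.of R (powTorsionSubmodule J E)) :=
    Module.injective_object_of_injective_module R _
  have := subsingleton_of_injective (J := J) (i := i)
    (ModuleCat.of R (powTorsionSubmodule J E))
  have htors := isPowTorsion_powTorsionSubmodule (J := J) E
  refine (injective_map_of_surjective hS fun p hp => ?_).subsingleton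
  obtain rfl : p = i := by omega
  cases p with
  | zero => exact surjective_map_zero_of_torsion _ (Submodule.mkQ_surjective _) htors
  | succ p =>
    have := ih p p.lt_succ_self
      (M := ModuleCat.of R (powTorsionSubmodule J E ⧸ LinearMap.range f))
      (htors.of_surjective (LinearMap.range f).mkQ (Submodule.mkQ_surjective _))
    exact Function.surjective_to_subsingleton _

lemma Represents.smul {t : ℕ} {M : ModuleCat.{u} R} {x : (localCohomology J i).obj M}
    {f : (resolution J t).complex.X i ⟶ M} (hx : Represents t x f) (a : R) :
    Represents t (a • x) (a • f) := by
  obtain ⟨x, hx, rfl⟩ := hx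
  exact ⟨a • x, hx.smul a, map_smul (ofExt J i t M).hom a x⟩

lemma map_smul_id {M : ModuleCat.{u} R} (a : R) (x : (localCohomology J i).obj M) :
    (localCohomology J i).map (a • 𝟙 M) x = a • x := by
  obtain ⟨t, f, hf⟩ := exists_represents x
  have := hf.map (a • 𝟙 M)
  rw [Linear.comp_smul, Category.comp_id] at this
  exact this.eq (hf.smul a)

instance subsingleton_obj (M : ModuleCat.{u} R) [Subsingleton M] :
    Subsingleton ((localCohomology J i).obj M) := by
  refine subsingleton_of_forall_eq 0 fun x => ?_
  obtain ⟨t, f, hf⟩ := exists_represents x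
  refine hf.eq_zero_of_coboundary (p := 0) 0 ?_
  exact ModuleCat.hom_ext (LinearMap.ext fun _ => Subsingleton.elim _ _)

lemma subsingleton_of_shortExact {S : ShortComplex (ModuleCat.{u} R)} (hS : S.ShortExact)
    [Subsingleton ((localCohomology J i).obj S.X₁)]
    [Subsingleton ((localCohomology J i).obj S.X₃)] :
    Subsingleton ((localCohomology J i).obj S.X₂) := by
  refine subsingleton_of_forall_eq 0 fun x => ?_
  obtain ⟨y, rfl⟩ := (exact_map hS x).1 (Subsingleton.elim _ _)
  rw [Subsingleton.elim y 0]
  exact map_zero ((localCohomology J i).map S.f).hom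

open IsLocalRing Module Pointwise in
/-- Grothendieck's vanishing theorem for local cohomology. -/
theorem subsingleton_of_supportDim_lt [IsLocalRing R] [IsNoetherianRing R] (n : ℕ) (M : Type u)
    [AddCommGroup M] [Module R M] [Module.Finite R M] (h : supportDim R M < n) :
    Subsingleton ((localCohomology (maximalIdeal R) n).obj (ModuleCat.of R M)) := by
  induction n generalizing M with
  | zero =>
    have : Subsingleton M := (supportDim_eq_bot_iff_subsingleton R M).1 <| by
      by_contra hne
      obtain ⟨d, hd⟩ := WithBot.ne_bot_iff_exists.1 hne
      rw [← hd] at h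
      exact absurd (WithBot.coe_lt_coe.1 h) (by simp)
    infer_instance
  | succ n ih =>
    -- Dévissage to the modules `R/𝔭`: the bound on the dimension passes to submodules and
    -- quotients.
    revert h
    induction ‹Module.Finite R M› using
      IsNoetherianRing.induction_on_isQuotientEquivQuotientPrime with
    | subsingleton N => infer_instance
    | exact N₁ N₂ N₃ f g hf hg hfg h₁ h₃ =>
      intro h
      have := h₁ ((supportDim_le_of_injective f hf).trans_lt h)
      have := h₃ ((supportDim_le_of_surjective g hg).trans_lt h)
      exact subsingleton_of_shortExact (shortExact_moduleCat f g hf hfg hg)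
    | quotient N p e =>
      intro h
      by_cases hp : maximalIdeal R ≤ p.1
      · refine subsingleton_of_isPowTorsion fun b => ⟨1, fun a ha => ?_⟩
        rw [pow_one] at ha
        apply e.injective
        rw [map_smul, map_zero]
        obtain ⟨c, hc⟩ := Ideal.Quotient.mk_surjective (e b)
        rw [← hc, Algebra.smul_def, Ideal.Quotient.algebraMap_eq,
          Ideal.Quotient.eq_zero_iff_mem.2 (hp ha), zero_mul]
      -- An `x ∈ 𝔪 ∖ 𝔭` is regular on `R/𝔭`, and dividing by it lowers the dimension by one. By
      -- induction `x` then acts injectively on `H^{n+1}`, while every class is killed by a power of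
      -- `x`.
      · obtain ⟨x, hx, hxp⟩ := SetLike.not_le_iff_exists.1 hp
        have hreg : IsSMulRegular N x := by
          refine (isSMulRegular_iff_right_eq_zero_of_smul).2 fun b hb => ?_
          apply e.injective
          have hb' : x • e b = 0 := by rw [← map_smul, hb, map_zero]
          obtain ⟨c, hc⟩ := Ideal.Quotient.mk_surjective (e b)
          rw [← hc, Algebra.smul_def, Ideal.Quotient.algebraMap_eq, ← map_mul,
            Ideal.Quotient.eq_zero_iff_mem] at hb'
          rw [map_zero, ← hc, Ideal.Quotient.eq_zero_iff_mem]
          exact (p.2.mem_or_mem hb').resolve_left hxp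
        have hdim := supportDim_quotSMulTop_succ_eq_supportDim hreg hx
        have := ih (QuotSMulTop x N) (by
          rw [← hdim, Nat.cast_add, Nat.cast_one] at h
          exact lt_of_add_lt_add_right h)
        have hS := shortExact_moduleCat (LinearMap.lsmul R N x)
          (Submodule.mkQ (x • ⊤ : Submodule R N)) hreg
          (LinearMap.exact_iff.2 <| by
            rw [Submodule.ker_mkQ, LinearMap.range_eq_map]; rfl) (Submodule.mkQ_surjective _)
        have hinj := injective_map_of_surjective (i := n + 1) (J := maximalIdeal R) hS
          fun p hp => by
            obtain rfl : p = n := by omega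
            exact @Function.surjective_to_subsingleton _ _ ⟨0⟩ this _
        have hinj' (y : (localCohomology (maximalIdeal R) (n + 1)).obj (ModuleCat.of R N))
            (hy : x • y = 0) : y = 0 := by
          refine hinj ?_
          refine .trans ?_ (map_zero ((localCohomology (maximalIdeal R) (n + 1)).map _).hom).symm
          exact (map_smul_id x y).trans hy
        refine subsingleton_of_forall_eq 0 fun y => ?_
        obtain ⟨t, ht⟩ := exists_pow_smul_eq_zero y
        have key (s : ℕ) (hy : x ^ s • y = 0) : y = 0 := by
          induction s with
          | zero => rwa [pow_zero, one_smul] at hy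
          | succ s hs =>
            rw [pow_succ', mul_smul] at hy
            exact hs (hinj' _ hy)
        exact key t (ht _ (Ideal.pow_mem_pow hx t))

end localCohomology

/-! ### Flatness in codimension `t - 1` bounds the dimension of kernels after base change. -/

namespace LocalCohomologyLifting

open TopologicalSpace

/-- The closure of `x` competes in the infimum, and taking closures of images is strictly monotone
on irreducible closed subsets, so chains above it map to chains in `Y`. -/
lemma topologicalCodim_preimage_le_coheight {X Y : Type u} [TopologicalSpace X]
    [TopologicalSpace Y] {f : X → Y} (hf : Topology.IsInducing f) {Z : Set Y} (hZ : IsClosed Z)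
    {x : X} (hx : f x ∈ Z) :
    topologicalCodim (f ⁻¹' Z) ≤
      Order.coheight (⟨closure {f x}, isIrreducible_singleton.closure, isClosed_closure⟩ :
        IrreducibleCloseds Y) := by
  let W : IrreducibleCloseds X := ⟨closure {x}, isIrreducible_singleton.closure, isClosed_closure⟩
  have hW : (W : Set X) ⊆ f ⁻¹' Z :=
    closure_minimal (Set.singleton_subset_iff.2 hx) (hZ.preimage hf.continuous)
  refine (iInf₂_le W hW).trans ?_
  refine (Order.coheight_le_coheight_apply_of_strictMono _
    (IrreducibleCloseds.map_strictMono_of_isInducing hf) W).trans_eq ?_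
  congr 1
  ext1
  change closure (f '' closure {x}) = closure {f x}
  rw [closure_image_closure hf.continuous, Set.image_singleton]

lemma coheight_closure_singleton {R : Type u} [CommRing R] (p : PrimeSpectrum R) :
    Order.coheight (⟨closure {p}, isIrreducible_singleton.closure, isClosed_closure⟩ :
      IrreducibleCloseds (PrimeSpectrum R)) = Order.height p := by
  rw [← Order.height_orderIso (PrimeSpectrum.pointsEquivIrreducibleCloseds R) p]
  rfl

variable {S R : Type u} [CommRing S] [CommRing R] [Algebra S R]

/-- Each point is seen in its own fibre, which is topologically embedded in `Spec R`; chains of the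
fibre are thus chains of `Spec R`. -/
lemma le_height_of_mem [IsLocalRing S] [IsArtinianRing S] {Z : Set (PrimeSpectrum R)}
    (hZ : IsClosed Z) {c : ℕ∞}
    (h : ∀ y : (Spec (.of S) : Scheme.{u}), c ≤ topologicalCodim
      ((Spec.map (CommRingCat.ofHom (algebraMap S R))).fiberι y ⁻¹' Z))
    {p : PrimeSpectrum R} (hp : p ∈ Z) : c ≤ Order.height p := by
  set f := Spec.map (CommRingCat.ofHom (algebraMap S R))
  have hx := f.fiberι_asFiber p
  refine (h (f p)).trans ?_
  refine (topologicalCodim_preimage_le_coheight (f.fiberι _).isEmbedding.isInducing hZ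
    (x := f.asFiber p) (by rwa [hx])).trans ?_
  rw [← coheight_closure_singleton]
  simp only [hx]
  exact le_rfl

/-- Flatness is tested on a basic open `D(g) ⊆ U` around `p`, and `R_𝔭` is a localization of `R_g`.
-/
lemma flat_localization {U : (Spec (.of R) : Scheme.{u}).Opens}
    (h : Flat (U.ι ≫ Spec.map (CommRingCat.ofHom (algebraMap S R)))) (p : PrimeSpectrum R)
    (hp : p ∈ U) : Module.Flat S (Localization.AtPrime p.asIdeal) := by
  obtain ⟨_, ⟨_, ⟨g, rfl⟩, rfl⟩, hpg, hgU⟩ :=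
    PrimeSpectrum.isBasis_basic_opens.exists_subset_of_mem_open (a := p) hp U.2
  let φ : CommRingCat.of R ⟶ CommRingCat.of (Localization.Away g) :=
    CommRingCat.ofHom (algebraMap R (Localization.Away g))
  have hrange : Set.range (Spec.map φ) ⊆ Set.range U.ι := by
    rw [Scheme.Opens.range_ι]
    exact (PrimeSpectrum.localization_away_comap_range (Localization.Away g) g).trans_subset hgU
  have : IsOpenImmersion (Spec.map φ) := inferInstance
  let l := IsOpenImmersion.lift U.ι (Spec.map φ) hrange
  have hl : l ≫ U.ι = Spec.map φ := IsOpenImmersion.lift_fac _ _ _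
  have : IsOpenImmersion l := by
    have : IsOpenImmersion (l ≫ U.ι) := by rwa [hl]
    exact IsOpenImmersion.of_comp l U.ι
  have hflat : Flat (l ≫ U.ι ≫ Spec.map (CommRingCat.ofHom (algebraMap S R))) := inferInstance
  rw [← Category.assoc, hl, ← Spec.map_comp, Flat.SpecMap_iff] at hflat
  have : Module.Flat S (Localization.Away g) := by
    rw [← RingHom.flat_algebraMap_iff, IsScalarTower.algebraMap_eq S R]
    exact hflat
  have hle : Submonoid.powers g ≤ p.asIdeal.primeCompl := Submonoid.powers_le.2 hpg
  let := IsLocalization.localizationAlgebraOfSubmonoidLe (Localization.Away g)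
    (Localization.AtPrime p.asIdeal) _ _ hle
  have := IsLocalization.localization_isScalarTower_of_submonoid_le (Localization.Away g)
    (Localization.AtPrime p.asIdeal) _ _ hle
  have := IsLocalization.isLocalization_of_submonoid_le (Localization.Away g)
    (Localization.AtPrime p.asIdeal) _ _ hle
  have : Module.Flat (Localization.Away g) (Localization.AtPrime p.asIdeal) :=
    IsLocalization.flat _ (p.asIdeal.primeCompl.map (algebraMap R (Localization.Away g)))
  have : IsScalarTower S (Localization.Away g) (Localization.AtPrime p.asIdeal) :=
    .of_algebraMap_eq fun s => by
      rw [IsScalarTower.algebraMap_apply S R (Localization.AtPrime p.asIdeal),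
        IsScalarTower.algebraMap_apply S R (Localization.Away g),
        ← IsScalarTower.algebraMap_apply R (Localization.Away g)]
  exact Module.Flat.trans S (Localization.Away g) _

/-- A kernel element dies in `R_𝔭 ⊗ M`, because `f` stays injective after tensoring with the flat
module `R_𝔭`. It is therefore killed by an element outside `𝔭`. -/
lemma notMem_support_ker_baseChange {M N : Type*} [AddCommGroup M] [Module S M] [AddCommGroup N]
    [Module S N] (f : M →ₗ[S] N) (hf : Function.Injective f) (p : PrimeSpectrum R)
    [Module.Flat S (Localization.AtPrime p.asIdeal)] :
    p ∉ Module.support R (LinearMap.ker (f.baseChange R)) := by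
  rw [Module.notMem_support_iff']
  rintro ⟨z, hz⟩
  let A := Localization.AtPrime p.asIdeal
  let gM : R ⊗[S] M →ₗ[R] A ⊗[S] M :=
    TensorProduct.AlgebraTensorModule.rTensor S M (Algebra.linearMap R A)
  let gN : R ⊗[S] N →ₗ[R] A ⊗[S] N :=
    TensorProduct.AlgebraTensorModule.rTensor S N (Algebra.linearMap R A)
  have hcomm (z : R ⊗[S] M) : gN (f.baseChange R z) = f.lTensor A (gM z) := by
    induction z with
    | zero => simp only [map_zero]
    | add x y hx hy => simp only [map_add, hx, hy]
    | tmul r m => rfl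
  have h0 : gM z = 0 := by
    refine Module.Flat.lTensor_preserves_injective_linearMap (M := A) f hf ?_
    rw [← hcomm, LinearMap.mem_ker.1 hz, map_zero, map_zero]
  obtain ⟨c, hc⟩ := (IsLocalizedModule.eq_zero_iff p.asIdeal.primeCompl gM).1 h0
  exact ⟨c, c.2, Subtype.ext hc⟩

/-- A chain in the support starts at some `p ∈ Z`, and `height p + coheight p ≤ n` leaves it length
at most `n - t`. For `t ≤ 0` the truncation `t.toNat` is `0`, and `n ≤ n - t` suffices. -/
lemma supportDim_lt {Z : Set (PrimeSpectrum R)} {n i : ℕ} {t : ℤ} (hn : ringKrullDim R = n)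
    (hi : (n : ℤ) - t < i) (hZ : ∀ p ∈ Z, (t.toNat : ℕ∞) ≤ Order.height p) {K : Type*}
    [AddCommGroup K] [Module R K] (hK : Module.support R K ⊆ Z) :
    Module.supportDim R K < i := by
  rw [Module.supportDim, Order.krullDim_lt_coe_iff]
  intro l
  let l' : LTSeries (PrimeSpectrum R) := l.map Subtype.val (Subtype.strictMono_coe _)
  have h1 := hZ l'.head (hK l.head.2)
  have h2 : (l.length : ℕ∞) ≤ Order.coheight l'.head := Order.length_le_coheight_head (p := l')
  have : Nonempty (PrimeSpectrum R) := ⟨l'.head⟩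
  have h3 := hn
  rw [ringKrullDim, Order.krullDim_eq_iSup_height_add_coheight_of_nonempty] at h3
  have h4 : (⨆ a : PrimeSpectrum R, Order.height a + Order.coheight a) = (n : ℕ∞) := by
    exact_mod_cast h3
  have h5 := (le_iSup (fun a : PrimeSpectrum R => Order.height a + Order.coheight a) l'.head)
  rw [h4] at h5
  have h6 : ((t.toNat + l.length : ℕ) : ℕ∞) ≤ n := by
    push_cast
    exact (add_le_add h1 h2).trans h5
  have h7 : t.toNat + l.length ≤ n := by exact_mod_cast h6
  omega

theorem supportDim_ker_baseChange_lt [IsLocalRing S] [IsArtinianRing S] {n i : ℕ} {t : ℤ}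
    (hn : ringKrullDim R = n) (hi : (n : ℤ) - t < i)
    (hflat : FlatInCodimension (Spec.map (CommRingCat.ofHom (algebraMap S R))) (t - 1))
    {M N : Type*} [AddCommGroup M] [Module S M] [AddCommGroup N]
    [Module S N] (f : M →ₗ[S] N) (hf : Function.Injective f) :
    Module.supportDim R (LinearMap.ker (f.baseChange R)) < i := by
  obtain ⟨Z, hZ, hU⟩ := hflat
  rw [sub_add_cancel] at hZ
  refine supportDim_lt hn hi (Z := (show Set (PrimeSpectrum R) from (Z : Set (Spec (.of R)))))
    (fun p hp => le_height_of_mem (S := S) Z.isClosed hZ hp) fun p hp => ?_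
  by_contra hpZ
  have := flat_localization hU p hpZ
  exact notMem_support_ker_baseChange f hf p hp

end LocalCohomologyLifting

/-! ### The closed fibre, and the short exact sequence in local cohomology. -/

namespace LocalCohomologyLifting

section ClosedFibre

variable (S : Type u) [CommRing S] [IsLocalRing S] (R : Type u) [CommRing R] [Algebra S R]

lemma ker_algebraMap_closedFibre_le :
    RingHom.ker (algebraMap R (ClosedFibre S R)) ≤
      (IsLocalRing.maximalIdeal S).map (algebraMap S R) := by
  intro x hx
  let e := Algebra.TensorProduct.quotIdealMapEquivTensorQuot R (IsLocalRing.maximalIdeal S)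
  have h : e (algebraMap R _ x) = e 0 := (e.commutes x).trans <| .trans hx (map_zero e).symm
  exact Ideal.Quotient.eq_zero_iff_mem.1 (e.injective h)

lemma isNilpotent_ker_algebraMap_closedFibre [IsArtinianRing S] :
    IsNilpotent (RingHom.ker (algebraMap R (ClosedFibre S R))) := by
  obtain ⟨k, hk⟩ := (isArtinianRing_iff_isNilpotent_maximalIdeal S).1 inferInstance
  refine ⟨k, le_bot_iff.1 ((Ideal.pow_right_mono (ker_algebraMap_closedFibre_le S R) k).trans ?_)⟩
  rw [← Ideal.map_pow, hk]
  exact Ideal.map_bot.le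

end ClosedFibre

section LocalCoh

variable {R : Type u} [CommRing R] [IsLocalRing R] {M M' M'' : Type u} [AddCommGroup M]
  [Module R M] [AddCommGroup M'] [Module R M'] [AddCommGroup M''] [Module R M''] (i : ℕ)

lemma LocalCoh.map_id : LocalCoh.map i (LinearMap.id : M →ₗ[R] M) = LinearMap.id :=
  congrArg ModuleCat.Hom.hom
    ((localCohomology (IsLocalRing.maximalIdeal R) i).map_id (ModuleCat.of R M))

lemma LocalCoh.map_comp (g : M' →ₗ[R] M'') (f : M →ₗ[R] M') :
    LocalCoh.map i (g ∘ₗ f) = LocalCoh.map i g ∘ₗ LocalCoh.map i f :=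
  congrArg ModuleCat.Hom.hom ((localCohomology (IsLocalRing.maximalIdeal R) i).map_comp
    (ModuleCat.ofHom f) (ModuleCat.ofHom g))

lemma LocalCoh.map_bijective (e : M ≃ₗ[R] M') :
    Function.Bijective (LocalCoh.map i e.toLinearMap) := by
  refine Function.bijective_iff_has_inverse.2 ⟨LocalCoh.map i e.symm.toLinearMap, ?_, ?_⟩ <;>
    refine fun x => (LinearMap.comp_apply _ _ x).symm.trans ?_ <;>
    rw [← LocalCoh.map_comp]
  · rw [e.symm_comp, LocalCoh.map_id, LinearMap.id_apply]
  · rw [e.comp_symm, LocalCoh.map_id, LinearMap.id_apply]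

variable {i} in
/-- For a right exact sequence whose first map has a kernel of small dimension and such that the
last map is surjective on local cohomology in two consecutive degrees, the local cohomology
modules form a short exact sequence. -/
theorem LocalCoh.shortExact_of_surjective [IsNoetherianRing R] {f : M →ₗ[R] M'}
    {g : M' →ₗ[R] M''} [Module.Finite R M]
    (hfg : Function.Exact f g) (hg : Function.Surjective g)
    (hker : Module.supportDim R (LinearMap.ker f) < i)
    (hpred : ∀ p, p + 1 = i → Function.Surjective (LocalCoh.map p g)) :
    Function.Injective (LocalCoh.map i f) ∧
      Function.Exact (LocalCoh.map i f) (LocalCoh.map i g) := by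
  have hI : Function.Exact (LinearMap.range f).subtype g := by
    rw [LinearMap.exact_iff, Submodule.range_subtype, LinearMap.exact_iff.1 hfg]
  have hS := localCohomology.shortExact_moduleCat (LinearMap.range f).subtype g
    (Submodule.subtype_injective _) hI hg
  have hT := localCohomology.shortExact_moduleCat (LinearMap.ker f).subtype f.rangeRestrict
    (Submodule.subtype_injective _)
    (by rw [LinearMap.exact_iff, LinearMap.ker_rangeRestrict, Submodule.range_subtype])
    f.surjective_rangeRestrict
  -- Vanishing for `ker f` in degree `i` makes `H^i(M) → H^i(range f)` injective; vanishing in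
  -- degree `i + 1` makes it surjective.
  have h1 := localCohomology.subsingleton_of_supportDim_lt i _ hker
  have h2 := localCohomology.subsingleton_of_supportDim_lt (i + 1) _
    (hker.trans (by exact_mod_cast i.lt_succ_self))
  have hsurj : Function.Surjective (LocalCoh.map i f.rangeRestrict) :=
    @localCohomology.surjective_map_of_subsingleton _ _ _ i _ hT h2
  have hinj : Function.Injective (LocalCoh.map i f.rangeRestrict) := by
    refine (injective_iff_map_eq_zero _).2 fun x hx => ?_
    obtain ⟨y, rfl⟩ := (localCohomology.exact_map hT x).1 hx
    rw [show y = 0 from @Subsingleton.elim _ h1 _ _]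
    exact map_zero (LocalCoh.map i (LinearMap.ker f).subtype)
  have hinj' : Function.Injective (LocalCoh.map i (LinearMap.range f).subtype) :=
    localCohomology.injective_map_of_surjective hS hpred
  have hcomp : LocalCoh.map i f =
      LocalCoh.map i (LinearMap.range f).subtype ∘ₗ LocalCoh.map i f.rangeRestrict := by
    rw [← LocalCoh.map_comp]
    rfl
  have hex : Function.Exact (LocalCoh.map i (LinearMap.range f).subtype) (LocalCoh.map i g) :=
    localCohomology.exact_map hS
  rw [hcomp]
  refine ⟨hinj'.comp hinj, ?_⟩
  rw [LinearMap.exact_iff, LinearMap.range_comp, LinearMap.range_eq_top.2 hsurj,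
    Submodule.map_top]
  exact LinearMap.exact_iff.1 hex

end LocalCoh

variable {S : Type u} [CommRing S] [IsLocalRing S] [IsArtinianRing S] {R : Type u} [CommRing R]
  [IsLocalRing R] [IsNoetherianRing R] [Algebra S R] [IsLocalHom (algebraMap S R)]

/-- If the closed fibre has liftable local cohomology, then the local cohomology of `f^* N`
surjects onto that of `f^* k` for every surjection `N → k`. -/
theorem surjective_map_of_hasLiftableLocalCoh {i : ℕ}
    (h : HasLiftableLocalCoh S (ClosedFibre S R) i) {N Q : Type u} [AddCommGroup N] [Module S N]
    [AddCommGroup Q] [Module S Q] (g : N →ₗ[S] Q) (hg : Function.Surjective g)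
    (e : Q ≃ₗ[S] IsLocalRing.ResidueField S) :
    Function.Surjective (LocalCoh.map i (g.baseChange R)) := by
  obtain ⟨b, hb⟩ := hg (e.symm 1)
  let eR : R ⊗[S] Q ≃ₗ[R] ClosedFibre S R := e.baseChange S R _ _
  let ψ : R →ₗ[R] R ⊗[S] N := LinearMap.toSpanSingleton R _ (1 ⊗ₜ b)
  -- Since `b` lies over `1`, the structure map of the closed fibre factors through `f^*N`.
  -- Liftability is applied to `R` itself as a nilpotent thickening of the closed fibre.
  have hcomp : Algebra.linearMap R (ClosedFibre S R) =
      eR.toLinearMap ∘ₗ g.baseChange R ∘ₗ ψ := by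
    refine LinearMap.ext_ring ?_
    simp [ψ, eR, hb]
  have hsurj := h R (algebraMap_closedFibre_surjective S R)
    (isNilpotent_ker_algebraMap_closedFibre S R)
  intro y
  obtain ⟨x, hx⟩ := hsurj (LocalCoh.map i eR.toLinearMap y)
  refine ⟨LocalCoh.map i ψ x, (LocalCoh.map_bijective i eR).1 ?_⟩
  rw [← hx, hcomp, LocalCoh.map_comp, LocalCoh.map_comp]
  rfl

end LocalCohomologyLifting
open LocalCohomologyLifting in
theorem proposition3p10
    -- an Artinian local ring `(S, 𝔪, k)`
    (S : Type u) [CommRing S] [IsLocalRing S] [IsArtinianRing S]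
    -- a local scheme `X = Spec R` of dimension `n` and a local morphism `f : X → Spec S`
    (R : Type u) [CommRing R] [IsLocalRing R] [IsNoetherianRing R] [Algebra S R]
    [IsLocalHom (algebraMap S R)]
    (n : ℕ) (hn : ringKrullDim R = n)
    -- `f` is flat in codimension `t - 1`
    (t : ℤ) (hflat : FlatInCodimension (Spec.map (CommRingCat.ofHom (algebraMap S R))) (t - 1))
    -- the closed fibre has liftable `i`-th local cohomology over `S` for `i ≥ n - t`
    (hlift : ∀ i : ℕ, (n : ℤ) - t ≤ i → HasLiftableLocalCoh S (ClosedFibre S R) i)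
    -- a finite `S`-module with a filtration whose successive quotients are isomorphic to `k`
    (N : Type u) [AddCommGroup N] [Module S N] [Module.Finite S N]
    (q : ℕ) (F : Fin (q + 2) → Submodule S N) (hF : IsMaximalFiltration F)
    (i : ℕ) (hi : (n : ℤ) - t < i) (j : Fin (q + 1)) :
    -- `0 → H^i_x(f^* N_{j+1}) → H^i_x(f^* N_j) → H^i_x(f^* (N_j / N_{j+1})) → 0` is exact
    Function.Injective
      (LocalCoh.map i ((Submodule.inclusion (hF.succ_lt j).le).baseChange R)) ∧
    Function.Exact
      (LocalCoh.map i ((Submodule.inclusion (hF.succ_lt j).le).baseChange R))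
      (LocalCoh.map i (((F j.succ).submoduleOf (F j.castSucc)).mkQ.baseChange R)) ∧
    Function.Surjective
      (LocalCoh.map i (((F j.succ).submoduleOf (F j.castSucc)).mkQ.baseChange R)) ∧
    -- every isomorphism `N_j / N_{j+1} ≃ k` induces an isomorphism
    -- `H^i_x(f^* (N_j / N_{j+1})) ≃ H^i_x(𝒪_{X_k})`
    ∀ e : (F j.castSucc ⧸ (F j.succ).submoduleOf (F j.castSucc)) ≃ₗ[S]
        IsLocalRing.ResidueField S,
      Function.Bijective
        (LocalCoh.map (M' := ClosedFibre S R) i (e.toLinearMap.baseChange R)) := by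

  have hex : Function.Exact
      ((Submodule.inclusion (hF.succ_lt j).le).baseChange R)
      (((F j.succ).submoduleOf (F j.castSucc)).mkQ.baseChange R) := by
    have hN : Function.Exact (Submodule.inclusion (hF.succ_lt j).le)
        ((F j.succ).submoduleOf (F j.castSucc)).mkQ := by
      rw [LinearMap.exact_iff, Submodule.ker_mkQ, Submodule.range_inclusion]
      rfl
    exact lTensor_exact R hN (Submodule.mkQ_surjective _)
  have hsurj : Function.Surjective (((F j.succ).submoduleOf (F j.castSucc)).mkQ.baseChange R) :=
    LinearMap.lTensor_surjective R (Submodule.mkQ_surjective _)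
  have hH (p : ℕ) (hp : (n : ℤ) - t ≤ p) : Function.Surjective
      (LocalCoh.map p (((F j.succ).submoduleOf (F j.castSucc)).mkQ.baseChange R)) :=
    (hF.quotient_equiv j).elim
      (surjective_map_of_hasLiftableLocalCoh (hlift p hp) _ (Submodule.mkQ_surjective _))
  obtain ⟨hinj, hmid⟩ := LocalCoh.shortExact_of_surjective hex hsurj
    (supportDim_ker_baseChange_lt hn hi hflat _ (Submodule.inclusion_injective _))
    -- Liftability at the boundary degree `n - t` is needed here: `p = i - 1` may equal `n - t`.
    fun p hp => hH p (by omega)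
  refine ⟨hinj, hmid, hH i hi.le, fun e => ?_⟩
  exact LocalCoh.map_bijective i (e.baseChange S R _ _)
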